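/- Let $p$ be a prime number, let $G$ be a $p$-adic analytic group (that is, a topological group whose topology underlies the structure of a finite-dimensional analytic manifold over $\mathbb{Q}_p$ for which multiplication and inversion are analytic; $G$ need not be compact), and let $k$ be a field of positive characteristic, not necessarily equal to $p$. For a representation $V$ of $G$ on a $k$-vector space (with no continuity condition), let $$V^{\mathrm{sm}} := \bigcup_{K} V^K, \qquad V^K := \{v \in V : xv = v \text{ for all } x \in K\},$$ where $K$ runs through the compact open subgroups of $G$; this is a subrepresentation of $V$, called the smooth part of $V$. Then, for every representation $V$ of $G$ on a $k$-vector space, $$(V/V^{\mathrm{sm}})^{\mathrm{sm}} = \{0\}.$$ -/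

import Mathlib

open scoped Manifold ContDiff

/-- A topological group `G` is `p`-adic analytic if its topology underlies the structure of a
finite-dimensional analytic manifold over `ℚ_p` for which multiplication and inversion are
analytic, i.e. if it is the topological group of a Lie group over `ℚ_p`
(in Mathlib, the order of smoothness `ω` means analytic). -/
def IsPAdicAnalyticGroup (p : ℕ) [Fact p.Prime] (G : Type*) [Group G] [TopologicalSpace G] :
    Prop :=
  ∃ (d : ℕ) (_ : ChartedSpace (Fin d → ℚ_[p]) G), LieGroup 𝓘(ℚ_[p], Fin d → ℚ_[p]) ω G

namespace SmoothRep

section Definitions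

variable {k G V : Type*} [Field k] [Group G] [AddCommGroup V] [Module k V]

/-- The space `V^K` of vectors fixed by the subgroup `K`. -/
noncomputable def fixedBy (ρ : Representation k G V) (K : Subgroup G) : Submodule k V :=
  Representation.invariants (ρ.comp K.subtype)

theorem mem_fixedBy (ρ : Representation k G V) (K : Subgroup G) (v : V) :
    v ∈ fixedBy ρ K ↔ ∀ x ∈ K, ρ x v = v :=
  ⟨fun h x hx => h ⟨x, hx⟩, fun h x => h x.1 x.2⟩

variable [TopologicalSpace G]

/-- The smooth part `V^sm`, the sum of the subspaces `V^K` over all compact open subgroups `K`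
of `G`. When `G` has a compact open subgroup this sum is the union of the `V^K`
(`mem_smoothPart_iff`); every `p`-adic analytic group has one
(`IsPAdicAnalyticGroup.exists_compact_open_subgroup`). -/
noncomputable def smoothPart (ρ : Representation k G V) : Submodule k V :=
  ⨆ K : {K : Subgroup G // IsOpen (K : Set G) ∧ IsCompact (K : Set G)}, fixedBy ρ K.1

variable [IsTopologicalGroup G]

/-- The smooth part is stable under the action of `G`. -/
theorem smoothPart_le_comap (ρ : Representation k G V) (g : G) :
    smoothPart ρ ≤ (smoothPart ρ).comap (ρ g) := by
  refine iSup_le fun K v hv => ?_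
  rw [mem_fixedBy] at hv
  have hcont : Continuous fun x : G => g⁻¹ * x * g := by fun_prop
  let L : Subgroup G := K.1.map (MulAut.conj g).toMonoidHom
  have hL : (L : Set G) = (fun x : G => g⁻¹ * x * g) ⁻¹' (K.1 : Set G) := by
    ext x
    simp only [L, Subgroup.coe_map, Set.mem_image, Set.mem_preimage, SetLike.mem_coe]
    constructor
    · rintro ⟨y, hy, rfl⟩
      simpa [mul_assoc] using hy
    · intro h
      exact ⟨_, h, by simp [mul_assoc]⟩
  have hLo : IsOpen (L : Set G) := hL ▸ K.2.1.preimage hcont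
  have hLc : IsCompact (L : Set G) := by
    have h : Continuous fun x : G => g * x * g⁻¹ := by fun_prop
    exact K.2.2.image h
  refine Submodule.mem_iSup_of_mem (p := fun K :
    {K : Subgroup G // IsOpen (K : Set G) ∧ IsCompact (K : Set G)} => fixedBy ρ K.1)
    ⟨L, hLo, hLc⟩ ?_
  rw [mem_fixedBy]
  rintro _ ⟨y, hy, rfl⟩
  have h : MulAut.conj g y * g = g * y := by simp
  change ρ (MulAut.conj g y) (ρ g v) = ρ g v
  rw [← Module.End.mul_apply, ← map_mul, h, map_mul, Module.End.mul_apply, hv y hy]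

/-- The representation of `G` on `V / V^sm`. -/
noncomputable def quotientSmoothPart (ρ : Representation k G V) : Representation k G (V ⧸ smoothPart ρ) :=
  ρ.quotient (smoothPart ρ) (smoothPart_le_comap ρ)

/-- When `G` has a compact open subgroup, `V^sm` is the union of the `V^K`. -/
theorem mem_smoothPart_iff (hG : ∃ K : Subgroup G, IsOpen (K : Set G) ∧ IsCompact (K : Set G))
    (ρ : Representation k G V) (v : V) :
    v ∈ smoothPart ρ ↔ ∃ K : Subgroup G, IsOpen (K : Set G) ∧ IsCompact (K : Set G) ∧
      ∀ x ∈ K, ρ x v = v := by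
  obtain ⟨K₀, hK₀⟩ := hG
  have : Nonempty {K : Subgroup G // IsOpen (K : Set G) ∧ IsCompact (K : Set G)} := ⟨⟨K₀, hK₀⟩⟩
  rw [smoothPart, Submodule.mem_iSup_of_directed]
  · simp only [Subtype.exists, mem_fixedBy, exists_prop, and_assoc]
  · intro K L
    refine ⟨⟨K.1 ⊓ L.1, K.2.1.inter L.2.1,
      K.2.2.inter_right (Subgroup.isClosed_of_isOpen _ L.2.1)⟩, ?_, ?_⟩
    · intro v hv
      rw [mem_fixedBy] at hv ⊢
      exact fun x hx => hv x hx.1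
    · intro v hv
      rw [mem_fixedBy] at hv ⊢
      exact fun x hx => hv x hx.2

end Definitions

end SmoothRep

open Pointwise in
/-- A `p`-adic analytic group has a compact open subgroup. -/
theorem IsPAdicAnalyticGroup.exists_compact_open_subgroup {p : ℕ} [Fact p.Prime] {G : Type*}
    [Group G] [TopologicalSpace G] [IsTopologicalGroup G] (hG : IsPAdicAnalyticGroup p G) :
    ∃ K : Subgroup G, IsOpen (K : Set G) ∧ IsCompact (K : Set G) := by
  obtain ⟨d, hC, -⟩ := hG
  -- a compact open neighbourhood `C` of `1`
  obtain ⟨C, hCo, hCc, h1⟩ : ∃ C : Set G, IsOpen C ∧ IsCompact C ∧ (1 : G) ∈ C := by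
    let φ := chartAt (Fin d → ℚ_[p]) (1 : G)
    obtain ⟨ε, hε, hsub⟩ := Metric.nhds_basis_closedBall.mem_iff.1
      (φ.open_target.mem_nhds (φ.map_source (mem_chart_source _ (1 : G))))
    have ho : IsOpen (Metric.closedBall (φ 1) ε) := by
      rw [closedBall_pi _ hε.le]
      exact isOpen_set_pi Set.finite_univ
        fun i _ => IsUltrametricDist.isOpen_closedBall _ hε.ne'
    refine ⟨φ.symm '' Metric.closedBall (φ 1) ε, ?_, ?_, ?_⟩
    · exact φ.isOpen_image_symm_of_subset_target ho hsub
    · exact (isCompact_closedBall _ _).image_of_continuousOn (φ.continuousOn_symm.mono hsub)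
    · exact ⟨φ 1, Metric.mem_closedBall_self hε.le, φ.left_inv (mem_chart_source _ (1 : G))⟩
  -- the right stabilizer of `C`
  let H : Subgroup G :=
    { carrier := {g | ∀ x, x * g ∈ C ↔ x ∈ C}
      one_mem' := fun x => by simp
      mul_mem' := fun {a b} ha hb x => by rw [← mul_assoc, hb, ha]
      inv_mem' := fun {a} ha x => by rw [← ha (x * a⁻¹), inv_mul_cancel_right] }
  obtain ⟨T, hT, hCT⟩ := compact_open_separated_mul_right hCc hCo subset_rfl
  have hHo : IsOpen (H : Set G) := by
    refine Subgroup.isOpen_of_mem_nhds H (g := 1) ?_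
    filter_upwards [hT, inv_mem_nhds_one G hT] with g hg hg' x
    refine ⟨fun h => ?_, fun h => hCT (Set.mul_mem_mul h hg)⟩
    simpa using hCT (Set.mul_mem_mul h (Set.mem_inv.1 hg'))
  refine ⟨H, hHo, hCc.of_isClosed_subset (Subgroup.isClosed_of_isOpen _ hHo) fun g hg => ?_⟩
  simpa using (hg 1).2 h1

/-! Let the class of `v` in `V ⧸ V^sm` be fixed by a compact open `K`. For `g ∈ K` some power `g ^
m` fixes the smooth vector `ρ g v - v`, and hence so does each `b` in the closure of the powers of
`g ^ m`. As `b` commutes with `g`, the element `g` fixes `ρ b v - v`. That vector is smooth too, so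
its stabilizer is closed and contains `b`. Thus `b` acts unipotently of level two on `v`, and in
positive characteristic a power of `b` fixes `v` (`exists_closure_powers_le_vectorStabilizer`).

It remains to pass from procyclic subgroups to an open one: in a `p`-adic analytic group, products
of finitely many procyclic subgroups fill a neighbourhood of `1`, even after replacing generators by
powers (`IsPAdicAnalyticGroup.exists_generators`). This follows by successive approximation in a
chart where multiplication is nearly addition. -/

namespace SmoothRep

/-! ### Stabilizers of vectors and procyclic subgroups -/

variable {k G V : Type*} [Field k] [Group G] [AddCommGroup V] [Module k V]

/-- The subgroup of all elements of `G` that fix the vector `v`. -/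
def vectorStabilizer (ρ : Representation k G V) (v : V) : Subgroup G where
  carrier := {g | ρ g v = v}
  one_mem' := by simp
  mul_mem' {a b} ha hb := by
    change ρ (a * b) v = v
    rw [map_mul, Module.End.mul_apply, show ρ b v = v from hb, show ρ a v = v from ha]
  inv_mem' {a} ha := by
    change ρ a⁻¹ v = v
    conv_lhs => rw [← show ρ a v = v from ha]
    exact ρ.inv_self_apply a v

theorem mem_vectorStabilizer {ρ : Representation k G V} {v : V} {g : G} :
    g ∈ vectorStabilizer ρ v ↔ ρ g v = v := Iff.rfl

/-- In characteristic `n`, if `ρ b` acts unipotently of level two on `v`, then `b ^ n` fixes `v`. -/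
theorem pow_mem_vectorStabilizer (ρ : Representation k G V) {v : V} {b : G}
    (hb : ρ b (ρ b v - v) = ρ b v - v) {n : ℕ} (hn : (n : k) = 0) :
    b ^ n ∈ vectorStabilizer ρ v := by
  have key : ∀ m : ℕ, ρ (b ^ m) v = v + (m : k) • (ρ b v - v) := by
    intro m
    induction m with
    | zero => simp
    | succ m ih =>
      rw [pow_succ', map_mul, Module.End.mul_apply, ih, map_add, map_smul, hb]
      push_cast
      module
  rw [mem_vectorStabilizer, key, hn, zero_smul, add_zero]

theorem apply_sub_comm_of_commute (ρ : Representation k G V) {a b : G} (h : Commute a b) (v : V) :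
    ρ a (ρ b v - v) - (ρ b v - v) = ρ b (ρ a v - v) - (ρ a v - v) := by
  have h' : ρ a (ρ b v) = ρ b (ρ a v) := by
    rw [← Module.End.mul_apply, ← map_mul, h.eq, map_mul, Module.End.mul_apply]
  rw [map_sub, map_sub, h']
  abel

variable [TopologicalSpace G] [IsTopologicalGroup G]

/-- Open subgroups are closed, so for a smooth vector, being fixed passes from a set of group
elements to its closure. -/
theorem mem_smoothPart_iff_isOpen
    (hG : ∃ K : Subgroup G, IsOpen (K : Set G) ∧ IsCompact (K : Set G))
    (ρ : Representation k G V) (v : V) :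
    v ∈ smoothPart ρ ↔ IsOpen (vectorStabilizer ρ v : Set G) := by
  rw [mem_smoothPart_iff hG]
  constructor
  · rintro ⟨K, hKo, -, hK⟩
    exact Subgroup.isOpen_mono (H₁ := K) (fun x hx => hK x hx) hKo
  · intro h
    obtain ⟨K, hKo, hKc⟩ := hG
    exact ⟨K ⊓ vectorStabilizer ρ v, hKo.inter h,
      hKc.inter_right (Subgroup.isClosed_of_isOpen _ h), fun x hx => hx.2⟩

theorem exists_pow_mem_of_isOpen_of_isCompact {K U : Subgroup G} (hK : IsCompact (K : Set G))
    (hU : IsOpen (U : Set G)) {g : G} (hg : g ∈ K) : ∃ m : ℕ, 0 < m ∧ g ^ m ∈ U := by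
  have : CompactSpace K := isCompact_iff_compactSpace.1 hK
  have hUK : IsOpen (U.subgroupOf K : Set K) := hU.preimage continuous_subtype_val
  have := Subgroup.quotient_finite_of_isOpen _ hUK
  have := Subgroup.finiteIndex_of_finite_quotient (H := U.subgroupOf K)
  obtain ⟨m, hm, -, h⟩ := Subgroup.exists_pow_mem_of_index_ne_zero
    (H := U.subgroupOf K) Subgroup.FiniteIndex.index_ne_zero ⟨g, hg⟩
  exact ⟨m, hm, h⟩

variable [T2Space G]

/-- If all `ρ g v - v` for `g` in the compact group `K` are smooth, then in positive
characteristic every procyclic subgroup of `K` has an open subgroup fixing `v`. -/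
theorem exists_closure_powers_le_vectorStabilizer
    (hG : ∃ K : Subgroup G, IsOpen (K : Set G) ∧ IsCompact (K : Set G)) (hk : 0 < ringChar k)
    (ρ : Representation k G V) {v : V} {K : Subgroup G} (hK : IsCompact (K : Set G))
    (hv : ∀ g ∈ K, ρ g v - v ∈ smoothPart ρ) {g : G} (hg : g ∈ K) :
    ∃ M : ℕ, 0 < M ∧
      closure (Submonoid.powers (g ^ M) : Set G) ⊆ vectorStabilizer ρ v := by
  have hU := (mem_smoothPart_iff_isOpen hG ρ _).1 (hv g hg)
  obtain ⟨m, hm, hgm⟩ := exists_pow_mem_of_isOpen_of_isCompact hK hU hg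
  refine ⟨m * ringChar k, Nat.mul_pos hm hk, ?_⟩
  have hCK : closure (Submonoid.powers (g ^ m) : Set G) ⊆ K :=
    closure_minimal (Submonoid.powers_le.2 (K.pow_mem hg m)) hK.isClosed
  have hCU : closure (Submonoid.powers (g ^ m) : Set G) ⊆ vectorStabilizer ρ (ρ g v - v) :=
    closure_minimal (Submonoid.powers_le.2 hgm) (Subgroup.isClosed_of_isOpen _ hU)
  have hCg : closure (Submonoid.powers (g ^ m) : Set G) ⊆ closure (Submonoid.powers g) :=
    closure_mono (Submonoid.powers_le.2 ⟨m, rfl⟩)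
  have hcent : closure (Submonoid.powers g : Set G) ⊆ Set.centralizer {g} := by
    refine closure_minimal ?_ (Set.isClosed_centralizer _)
    rintro _ ⟨n, rfl⟩ a rfl
    exact ((Commute.refl a).pow_right n).eq
  -- The stabilizer of `v` is not known to be closed, so fixing the powers of `g ^ M` would not
  -- suffice. Instead `v` is shown to be fixed by a compact, hence closed, set containing those
  -- powers.
  have hfix : (fun b : G => b ^ ringChar k) '' closure (Submonoid.powers (g ^ m) : Set G) ⊆
      vectorStabilizer ρ v := by
    rintro _ ⟨b, hb, rfl⟩
    have hgb : Commute g b := hcent (hCg hb) g rfl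
    have h1 : ρ b (ρ g v - v) = ρ g v - v := hCU hb
    have h2 : ρ g (ρ b v - v) = ρ b v - v := by
      rw [← sub_eq_zero, apply_sub_comm_of_commute ρ hgb, h1, sub_self]
    have hS := (mem_smoothPart_iff_isOpen hG ρ _).1 (hv b (hCK hb))
    have h3 : closure (Submonoid.powers g : Set G) ⊆ vectorStabilizer ρ (ρ b v - v) :=
      closure_minimal (Submonoid.powers_le.2 h2) (Subgroup.isClosed_of_isOpen _ hS)
    exact pow_mem_vectorStabilizer ρ (h3 (hCg hb)) (ringChar.spec k _ |>.2 dvd_rfl)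
  refine (closure_minimal ?_ ?_).trans hfix
  · rintro _ ⟨n, rfl⟩
    refine ⟨(g ^ m) ^ n, subset_closure ⟨n, rfl⟩, ?_⟩
    simp only [← pow_mul]
    congr 1
    ring
  · exact ((hK.of_isClosed_subset isClosed_closure hCK).image (continuous_pow _)).isClosed

end SmoothRep

/-! ### Almost additive coordinates and products -/

open Metric Filter Topology

/-- A continuous parametrization of a neighbourhood of `1` in `G` by a ball in `E` in which the
multiplication of `G` differs from the addition of `E` by an `ε`-Lipschitz function. -/
structure AlmostAdditiveParam (G E : Type*) [Group G] [TopologicalSpace G]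
    [NormedAddCommGroup E] (ε : ℝ) where
  /-- the parametrization -/
  param : E → G
  /-- the multiplication of `G` in coordinates -/
  mul : E → E → E
  /-- the radius of the ball -/
  radius : ℝ
  radius_pos : 0 < radius
  continuousOn : ContinuousOn param (closedBall 0 radius)
  image_mem_nhds : ∀ t, 0 < t → t ≤ radius → param '' closedBall 0 t ∈ nhds (1 : G)
  param_zero : param 0 = 1
  zero_mul : ∀ x, ‖x‖ ≤ radius → mul 0 x = x
  mul_zero : ∀ x, ‖x‖ ≤ radius → mul x 0 = x
  param_mul : ∀ x y, ‖x‖ ≤ radius → ‖y‖ ≤ radius → param (mul x y) = param x * param y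
  norm_mul_sub_le : ∀ x y x' y', ‖x‖ ≤ radius → ‖y‖ ≤ radius → ‖x'‖ ≤ radius → ‖y'‖ ≤ radius →
    ‖mul x y - mul x' y' - (x - x') - (y - y')‖ ≤ ε * max ‖x - x'‖ ‖y - y'‖

theorem norm_add_le_of_le_of_le {E : Type*} [NormedAddCommGroup E] [IsUltrametricDist E]
    {x y : E} {c : ℝ} (hx : ‖x‖ ≤ c) (hy : ‖y‖ ≤ c) : ‖x + y‖ ≤ c :=
  (IsUltrametricDist.norm_add_le_max x y).trans (max_le hx hy)

namespace AlmostAdditiveParam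

section General

variable {G E : Type*} [Group G] [TopologicalSpace G] [NormedAddCommGroup E]
  [IsUltrametricDist E] {ε : ℝ} (P : AlmostAdditiveParam G E ε)

theorem norm_mul_sub_mul_le (hε : ε ≤ 1) {x y x' y' : E} (hx : ‖x‖ ≤ P.radius)
    (hy : ‖y‖ ≤ P.radius) (hx' : ‖x'‖ ≤ P.radius) (hy' : ‖y'‖ ≤ P.radius) {R : ℝ}
    (h : ‖x - x'‖ ≤ R) (h' : ‖y - y'‖ ≤ R) : ‖P.mul x y - P.mul x' y'‖ ≤ R := by
  have h1 : ‖P.mul x y - P.mul x' y' - (x - x') - (y - y')‖ ≤ R :=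
    (P.norm_mul_sub_le x y x' y' hx hy hx' hy').trans
      ((mul_le_of_le_one_left (le_max_of_le_left (norm_nonneg _)) hε).trans (max_le h h'))
  have : P.mul x y - P.mul x' y' =
      (P.mul x y - P.mul x' y' - (x - x') - (y - y')) + ((x - x') + (y - y')) := by abel
  rw [this]
  exact norm_add_le_of_le_of_le h1 (norm_add_le_of_le_of_le h h')

theorem norm_mul_le (hε : ε ≤ 1) {x y : E} {R : ℝ} (hR : R ≤ P.radius)
    (hx : ‖x‖ ≤ R) (hy : ‖y‖ ≤ R) : ‖P.mul x y‖ ≤ R := by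
  have h0 : ‖(0 : E)‖ ≤ P.radius := by simpa using P.radius_pos.le
  have := P.norm_mul_sub_mul_le hε (hx.trans hR) (hy.trans hR) h0 h0 (R := R)
    (by simpa using hx) (by simpa using hy)
  rwa [P.zero_mul 0 h0, sub_zero] at this

/-- The product of a family of points in coordinates. -/
def prod (l : List E) : E := l.foldr P.mul 0

theorem norm_prod_le (hε : ε ≤ 1) {n : ℕ} {c : Fin n → E} {R : ℝ} (hR0 : 0 ≤ R)
    (hR : R ≤ P.radius) (hc : ∀ i, ‖c i‖ ≤ R) : ‖P.prod (List.ofFn c)‖ ≤ R := by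
  induction n with
  | zero => simpa [prod] using hR0
  | succ n ih =>
    rw [List.ofFn_succ]
    exact P.norm_mul_le hε hR (hc 0) (ih fun i => hc i.succ)

theorem param_prod (hε : ε ≤ 1) {n : ℕ} {c : Fin n → E} (hc : ∀ i, ‖c i‖ ≤ P.radius) :
    P.param (P.prod (List.ofFn c)) = (List.ofFn fun i => P.param (c i)).prod := by
  induction n with
  | zero => simpa [prod] using P.param_zero
  | succ n ih =>
    rw [List.ofFn_succ, List.ofFn_succ, List.prod_cons, ← ih fun i => hc i.succ]
    exact P.param_mul _ _ (hc 0) (P.norm_prod_le hε P.radius_pos.le le_rfl fun i => hc i.succ)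

/-- Changing the factors changes the product by nearly the sum of the changes. The ultrametric
inequality keeps the errors from accumulating, so the bound does not depend on `n`. -/
theorem norm_prod_sub_prod_sub_sum_le (hε0 : 0 ≤ ε) (hε : ε ≤ 1) {n : ℕ} {c c' : Fin n → E}
    (hc : ∀ i, ‖c i‖ ≤ P.radius) (hc' : ∀ i, ‖c' i‖ ≤ P.radius) {R : ℝ} (hR : 0 ≤ R)
    (h : ∀ i, ‖c i - c' i‖ ≤ R) :
    ‖P.prod (List.ofFn c) - P.prod (List.ofFn c')‖ ≤ R ∧
    ‖P.prod (List.ofFn c) - P.prod (List.ofFn c') - ∑ i, (c i - c' i)‖ ≤ ε * R := by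
  induction n with
  | zero => simpa [prod] using ⟨hR, by positivity⟩
  | succ n ih =>
    obtain ⟨ih1, ih2⟩ := ih (fun i => hc i.succ) (fun i => hc' i.succ) fun i => h i.succ
    rw [List.ofFn_succ, List.ofFn_succ]
    have hq := P.norm_prod_le hε P.radius_pos.le le_rfl fun i => hc i.succ
    have hq' := P.norm_prod_le hε P.radius_pos.le le_rfl fun i => hc' i.succ
    refine ⟨P.norm_mul_sub_mul_le hε (hc 0) hq (hc' 0) hq' (h 0) ih1, ?_⟩
    have h1 := P.norm_mul_sub_le _ _ _ _ (hc 0) hq (hc' 0) hq'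
    have h2 := h1.trans (mul_le_mul_of_nonneg_left (max_le (h 0) ih1) hε0)
    rw [Fin.sum_univ_succ]
    convert norm_add_le_of_le_of_le h2 ih2 using 2
    simp only [prod, List.foldr_cons]
    abel

end General

/-! ### Powers in almost additive coordinates -/

section Padic

variable {p : ℕ} [Fact p.Prime] {G E : Type*} [Group G] [TopologicalSpace G]
  [NormedAddCommGroup E] [NormedSpace ℚ_[p] E] [IsUltrametricDist E]

theorem exists_param_eq_pow_of_norm_sub_le {ε : ℝ} (hε0 : 0 ≤ ε) (hε : ε ≤ 1)
    (P : AlmostAdditiveParam G E ε) {x : E} (hx : ‖x‖ ≤ P.radius) (n : ℕ) :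
    ∃ y, ‖y‖ ≤ ‖x‖ ∧ P.param y = P.param x ^ n ∧ ‖y - (n : ℚ_[p]) • x‖ ≤ ε * ‖x‖ := by
  have h0 : ‖(0 : E)‖ ≤ P.radius := by simpa using P.radius_pos.le
  induction n with
  | zero => exact ⟨0, by simp, by simpa using P.param_zero, by simpa using by positivity⟩
  | succ n ih =>
    obtain ⟨y, hy, hpow, hsub⟩ := ih
    refine ⟨P.mul y x, P.norm_mul_le hε hx hy le_rfl, ?_, ?_⟩
    · rw [P.param_mul _ _ (hy.trans hx) hx, hpow, pow_succ]
    · have h1 := P.norm_mul_sub_le y x 0 x (hy.trans hx) hx h0 hx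
      rw [P.zero_mul x hx, sub_self, norm_zero, max_eq_left (norm_nonneg _), sub_zero,
        sub_zero] at h1
      have h2 := h1.trans (mul_le_mul_of_nonneg_left hy hε0)
      convert norm_add_le_of_le_of_le h2 hsub using 2
      push_cast
      module

variable (P : AlmostAdditiveParam G E ((p : ℝ)⁻¹ ^ 2))

/-- The error is measured relative to `n • x`, so the estimate stays useful when `n` is highly
divisible by `p`. Factors `p` are split off one at a time; the constant `p⁻¹ ^ 2` leaves an error of
`p⁻¹` relative to `p • x`. -/
theorem exists_param_eq_pow {x : E} (hx : ‖x‖ ≤ P.radius) (n : ℕ) :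
    ∃ y, ‖y‖ ≤ ‖x‖ ∧ P.param y = P.param x ^ n ∧
      ‖y - (n : ℚ_[p]) • x‖ ≤ (p : ℝ)⁻¹ * (‖(n : ℚ_[p])‖ * ‖x‖) := by
  have hp1 : (1 : ℝ) < p := mod_cast (Fact.out : p.Prime).one_lt
  have hq0 : 0 ≤ (p : ℝ)⁻¹ := by positivity
  have hq1 : (p : ℝ)⁻¹ ≤ 1 := inv_le_one_of_one_le₀ hp1.le
  have hε : (p : ℝ)⁻¹ ^ 2 ≤ 1 := pow_le_one₀ hq0 hq1
  induction n using Nat.strong_induction_on generalizing x with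
  | _ n ih =>
    rcases Nat.eq_zero_or_pos n with rfl | hn
    · exact ⟨0, by simp, by simpa using P.param_zero, by simp⟩
    by_cases hpn : p ∣ n
    · obtain ⟨m, rfl⟩ := hpn
      obtain ⟨y, hy, hypow, hysub⟩ :=
        exists_param_eq_pow_of_norm_sub_le (p := p) (by positivity) hε P hx p
      have hm : 0 < m := Nat.pos_of_mul_pos_left hn
      obtain ⟨z, hz, hzpow, hzsub⟩ := ih m
        (lt_mul_of_one_lt_left hm (Fact.out : p.Prime).one_lt) (hy.trans hx)
      refine ⟨z, hz.trans hy, by rw [hzpow, hypow, pow_mul], ?_⟩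
      have hy' : ‖y‖ ≤ (p : ℝ)⁻¹ * ‖x‖ := by
        have h1 : ‖(p : ℚ_[p]) • x‖ ≤ (p : ℝ)⁻¹ * ‖x‖ := by rw [norm_smul, Padic.norm_p]
        have h2 : ‖y - (p : ℚ_[p]) • x‖ ≤ (p : ℝ)⁻¹ * ‖x‖ :=
          hysub.trans (mul_le_mul_of_nonneg_right (by nlinarith) (norm_nonneg _))
        simpa using norm_add_le_of_le_of_le h2 h1
      have e1 : ‖z - (m : ℚ_[p]) • y‖ ≤ (p : ℝ)⁻¹ * (‖((p * m : ℕ) : ℚ_[p])‖ * ‖x‖) := by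
        refine hzsub.trans (mul_le_mul_of_nonneg_left ?_ hq0)
        rw [Nat.cast_mul, norm_mul, Padic.norm_p, mul_comm (p : ℝ)⁻¹, mul_assoc]
        exact mul_le_mul_of_nonneg_left hy' (norm_nonneg _)
      have e2 : ‖(m : ℚ_[p]) • (y - (p : ℚ_[p]) • x)‖ ≤
          (p : ℝ)⁻¹ * (‖((p * m : ℕ) : ℚ_[p])‖ * ‖x‖) := by
        rw [norm_smul, Nat.cast_mul, norm_mul, Padic.norm_p]
        refine (mul_le_mul_of_nonneg_left hysub (norm_nonneg _)).trans (le_of_eq ?_)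
        ring
      convert norm_add_le_of_le_of_le e1 e2 using 2
      push_cast
      module
    -- Here `n` is a unit of `ℤ_p`, so the absolute error bound is already relative.
    · obtain ⟨y, hy, hypow, hysub⟩ :=
        exists_param_eq_pow_of_norm_sub_le (p := p) (by positivity) hε P hx n
      refine ⟨y, hy, hypow, hysub.trans ?_⟩
      have : ‖(n : ℚ_[p])‖ = 1 := by
        rw [Padic.norm_natCast_eq_one_iff]
        exact ((Fact.out : p.Prime).coprime_iff_not_dvd).2 hpn
      rw [this, one_mul]
      exact mul_le_mul_of_nonneg_right (by nlinarith) (norm_nonneg _)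

end Padic

end AlmostAdditiveParam

/-- Natural multiples of `a` approximate every element of `a ℤ_p`. -/
theorem Padic.exists_natCast_mul_sub_le {p : ℕ} [Fact p.Prime] {a u : ℚ_[p]} (ha : a ≠ 0)
    (hu : ‖u‖ ≤ ‖a‖) {δ : ℝ} (hδ : 0 < δ) : ∃ n : ℕ, ‖(n : ℚ_[p]) * a - u‖ ≤ δ := by
  have ha' : 0 < ‖a‖ := norm_pos_iff.2 ha
  have hz : ‖u / a‖ ≤ 1 := by rw [norm_div]; exact div_le_one_of_le₀ hu ha'.le
  obtain ⟨w, hw⟩ : ∃ w : ℤ_[p], (w : ℚ_[p]) = u / a := ⟨⟨u / a, hz⟩, rfl⟩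
  obtain ⟨n, hn⟩ := PadicInt.denseRange_natCast.exists_dist_lt w (div_pos hδ ha')
  refine ⟨n, ?_⟩
  rw [dist_comm, dist_eq_norm, PadicInt.norm_def, PadicInt.coe_sub, PadicInt.coe_natCast,
    hw, lt_div_iff₀ ha', ← norm_mul, sub_mul, div_mul_cancel₀ _ ha] at hn
  exact hn.le

/-! ### Almost additive coordinates on analytic groups -/

section LieGroupParam

variable {𝕜 E G : Type*} [NontriviallyNormedField 𝕜] [NormedAddCommGroup E]
  [NormedSpace 𝕜 E] [Group G] [TopologicalSpace G] [ChartedSpace E G]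

variable (E G) in
theorem chartAt_one_symm_apply :
    (chartAt E (1 : G)).symm (chartAt E (1 : G) 1) = 1 :=
  (chartAt E (1 : G)).left_inv (mem_chart_source E 1)

variable [LieGroup 𝓘(𝕜, E) ω G]

variable (𝕜 E G) in
/-- In the chart at `1`, the strict derivative of the multiplication of an analytic group at
`(1, 1)` is the addition. -/
theorem hasStrictFDerivAt_mul_chartAt_one [CompleteSpace E] :
    HasStrictFDerivAt (𝕜 := 𝕜)
      (fun q : E × E => chartAt E (1 : G)
        ((chartAt E (1 : G)).symm q.1 * (chartAt E (1 : G)).symm q.2))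
      (ContinuousLinearMap.fst 𝕜 E E + ContinuousLinearMap.snd 𝕜 E E)
      (chartAt E (1 : G) 1, chartAt E (1 : G) 1) := by
  set e := chartAt E (1 : G) with he
  set F : E × E → E := fun q => e (e.symm q.1 * e.symm q.2) with hF
  have hc : ContDiffAt 𝕜 ω F (e 1, e 1) := by
    have h := ((contMDiff_mul 𝓘(𝕜, E) ω (G := G)) ((1 : G), (1 : G)))
    rw [contMDiffAt_iff] at h
    have h2 := h.2
    simp only [mul_one, mfld_simps] at h2
    exact h2.contDiffAt (by simp)
  obtain ⟨L, hL⟩ : ∃ L, HasStrictFDerivAt (𝕜 := 𝕜) F L (e 1, e 1) :=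
    ⟨_, hc.analyticAt.hasStrictFDerivAt⟩
  have hs : e.symm (e 1) = 1 := chartAt_one_symm_apply E G
  have ht : e.target ∈ 𝓝 (e 1) := chart_target_mem_nhds E (1 : G)
  -- `L` is determined by its restrictions to the two factors, and there `F` is the identity near `e
  -- 1` because `1` is neutral.
  have h1 : L.comp (ContinuousLinearMap.inl 𝕜 E E) = ContinuousLinearMap.id 𝕜 E := by
    have hL' : HasFDerivAt (𝕜 := 𝕜) F L (e 1, e 1) := hL.hasFDerivAt
    have hg : HasFDerivAt (𝕜 := 𝕜) (fun x : E => (x, e 1))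
        (ContinuousLinearMap.inl 𝕜 E E) (e 1) := hasFDerivAt_prodMk_left _ _
    refine (HasFDerivAt.comp (f := fun x : E => (x, e 1)) (e 1) hL' hg).unique ((hasFDerivAt_id (e 1)).congr_of_eventuallyEq ?_)
    filter_upwards [ht] with x hx
    simp [hF, hs, e.right_inv hx]
  have h2 : L.comp (ContinuousLinearMap.inr 𝕜 E E) = ContinuousLinearMap.id 𝕜 E := by
    have hL' : HasFDerivAt (𝕜 := 𝕜) F L (e 1, e 1) := hL.hasFDerivAt
    have hg : HasFDerivAt (𝕜 := 𝕜) (fun x : E => (e 1, x))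
        (ContinuousLinearMap.inr 𝕜 E E) (e 1) := hasFDerivAt_prodMk_right _ _
    refine (HasFDerivAt.comp (f := fun x : E => (e 1, x)) (e 1) hL' hg).unique ((hasFDerivAt_id (e 1)).congr_of_eventuallyEq ?_)
    filter_upwards [ht] with x hx
    simp [hF, hs, e.right_inv hx]
  convert hL using 1
  ext x
  · simpa using (DFunLike.congr_fun h1 x).symm
  · simpa using (DFunLike.congr_fun h2 x).symm

end LieGroupParam

/-- Near `1`, the multiplication of an analytic group is as close to the addition of the model
space as desired. -/
theorem exists_almostAdditiveParam (𝕜 E : Type*) {G : Type*} [NontriviallyNormedField 𝕜]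
    [NormedAddCommGroup E] [NormedSpace 𝕜 E] [CompleteSpace E] [Group G] [TopologicalSpace G]
    [ChartedSpace E G] [LieGroup 𝓘(𝕜, E) ω G] [IsTopologicalGroup G] {U : Set G}
    (hU : U ∈ 𝓝 (1 : G)) {ε : ℝ} (hε : 0 < ε) :
    ∃ P : AlmostAdditiveParam G E ε, ∀ x, ‖x‖ ≤ P.radius → P.param x ∈ U := by
  have hd := hasStrictFDerivAt_mul_chartAt_one 𝕜 E G
  have hs := chartAt_one_symm_apply E G
  have ht := chart_target_mem_nhds E (1 : G)
  have h1 := mem_chart_source E (1 : G)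
  set e := chartAt E (1 : G) with he
  set a := e 1 with ha
  have hsc : ContinuousAt e.symm a := e.continuousAt_symm (e.map_source h1)
  have hUa : e.symm ⁻¹' U ∈ 𝓝 a := hsc.preimage_mem_nhds (by rwa [hs])
  have hm : {q : E × E | e.symm q.1 * e.symm q.2 ∈ e.source} ∈ 𝓝 (a, a) := by
    have hmc : ContinuousAt (fun q : E × E => e.symm q.1 * e.symm q.2) (a, a) :=
      (ContinuousAt.comp (x := (a, a)) hsc continuousAt_fst).mul
        (ContinuousAt.comp (x := (a, a)) hsc continuousAt_snd)
    refine hmc.preimage_mem_nhds (e.open_source.mem_nhds ?_)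
    simpa [hs] using h1
  -- Strict differentiability compares two arbitrary nearby points, which is the required Lipschitz
  -- bound.
  have hest := (hasStrictFDerivAt_iff_isLittleO.1 hd).def hε
  obtain ⟨r, ⟨⟨⟨hr1, hr2⟩, hr3⟩, hr4⟩, hr⟩ :=
    (((((eventually_closedBall_subset ht).and (eventually_closedBall_subset hUa)).and
      (eventually_closedBall_subset hm)).and
      (eventually_closedBall_subset hest)).filter_mono nhdsWithin_le_nhds |>.and
      (self_mem_nhdsWithin : Set.Ioi (0 : ℝ) ∈ 𝓝[>] 0)).exists
  have hmem : ∀ {x : E}, ‖x‖ ≤ r → x + a ∈ closedBall a r := fun {x} hx => by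
    simpa [dist_eq_norm] using hx
  have hmem2 : ∀ {x y : E}, ‖x‖ ≤ r → ‖y‖ ≤ r → (x + a, y + a) ∈ closedBall (a, a) r :=
    fun {x y} hx hy => by
      rw [← closedBall_prod_same]
      exact ⟨hmem hx, hmem hy⟩
  refine ⟨{ param := fun x => e.symm (x + a)
            mul := fun x y => e (e.symm (x + a) * e.symm (y + a)) - a
            radius := r
            radius_pos := hr
            continuousOn := ?_
            image_mem_nhds := ?_
            param_zero := by simpa using hs
            zero_mul := ?_
            mul_zero := ?_
            param_mul := ?_
            norm_mul_sub_le := ?_ }, fun x hx => hr2 (hmem hx)⟩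
  · refine (e.continuousOn_symm.mono hr1).comp (by fun_prop) fun x hx => hmem ?_
    simpa using hx
  · intro t ht0 htr
    filter_upwards [e.open_source.mem_nhds h1,
      (e.continuousAt h1).preimage_mem_nhds (closedBall_mem_nhds a ht0)] with g hg hg'
    refine ⟨e g - a, ?_, by simpa using e.left_inv hg⟩
    simpa [dist_eq_norm] using hg'
  · intro x hx
    simp [hs, e.right_inv (hr1 (hmem hx))]
  · intro x hx
    simp [hs, e.right_inv (hr1 (hmem hx))]
  · intro x y hx hy
    simpa using e.left_inv (hr3 (hmem2 hx hy))
  · intro x y x' y' hx hy hx' hy'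
    have hq : ((x + a, y + a), (x' + a, y' + a)) ∈ closedBall ((a, a), (a, a)) r := by
      rw [← closedBall_prod_same]
      exact ⟨hmem2 hx hy, hmem2 hx' hy'⟩
    have h := hr4 hq
    simp only [Set.mem_ofPred_eq, Prod.mk_sub_mk, add_sub_add_right_eq_sub,
      add_apply, ContinuousLinearMap.coe_fst',
      ContinuousLinearMap.coe_snd', Prod.norm_mk] at h
    refine Eq.trans_le (congrArg norm ?_) h
    abel

/-! ### Neighbourhoods of `1` as products of procyclic subgroups -/

section PadicGenerators

variable {p : ℕ} [Fact p.Prime] {G : Type*} [Group G] [TopologicalSpace G] {d : ℕ}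

/-- Newton-like approximation: each coordinate of the current error is nearly a natural multiple of
`M * π`, so multiplying the `i`-th factor by a suitable power of the `i`-th generator shrinks the
error by `p⁻¹`. -/
theorem AlmostAdditiveParam.exists_prod_pow_near
    (P : AlmostAdditiveParam G (Fin d → ℚ_[p]) ((p : ℝ)⁻¹ ^ 2)) {π : ℚ_[p]}
    (hπ0 : π ≠ 0) (hπ : ‖π‖ ≤ P.radius) {M : ℕ} (hM : 0 < M) {z : Fin d → ℚ_[p]}
    (hz : ‖z‖ ≤ ‖(M : ℚ_[p]) * π‖) (n : ℕ) :
    ∃ c : Fin d → Fin d → ℚ_[p], (∀ i, ‖c i‖ ≤ P.radius) ∧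
      (∀ i, P.param (c i) ∈ Submonoid.powers (P.param (Pi.single i π) ^ M)) ∧
      ‖z - P.prod (List.ofFn c)‖ ≤ ‖(M : ℚ_[p]) * π‖ * (p : ℝ)⁻¹ ^ n := by
  have hp1 : (1 : ℝ) < p := mod_cast (Fact.out : p.Prime).one_lt
  have hq0 : 0 < (p : ℝ)⁻¹ := by positivity
  have hq1 : (p : ℝ)⁻¹ ≤ 1 := inv_le_one_of_one_le₀ hp1.le
  have hε : (p : ℝ)⁻¹ ^ 2 ≤ 1 := pow_le_one₀ hq0.le hq1
  have hεq : (p : ℝ)⁻¹ ^ 2 ≤ (p : ℝ)⁻¹ := by nlinarith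
  have h0 : ‖(0 : Fin d → ℚ_[p])‖ ≤ P.radius := by simpa using P.radius_pos.le
  have hMπ : (M : ℚ_[p]) * π ≠ 0 := mul_ne_zero (Nat.cast_ne_zero.2 hM.ne') hπ0
  induction n with
  | zero =>
    refine ⟨fun _ => 0, fun _ => h0, fun i => ?_, ?_⟩
    · rw [P.param_zero]
      exact one_mem _
    · have := P.norm_prod_le hε le_rfl P.radius_pos.le
        (c := fun _ : Fin d => (0 : Fin d → ℚ_[p])) (by simp)
      rw [norm_le_zero_iff.1 this]
      simpa using hz
  | succ n ih =>
    obtain ⟨c, hc, hcpow, hcz⟩ := ih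
    set t := ‖(M : ℚ_[p]) * π‖ with ht
    have ht0 : 0 < t := norm_pos_iff.2 hMπ
    set ρ := t * (p : ℝ)⁻¹ ^ n with hρ
    have hρ0 : 0 < ρ := by positivity
    have hqρ : (p : ℝ)⁻¹ * ρ ≤ ρ := mul_le_of_le_one_left hρ0.le hq1
    have hρt : ρ ≤ t := mul_le_of_le_one_right ht0.le (pow_le_one₀ hq0.le hq1)
    set u := z - P.prod (List.ofFn c) with hu
    have hui : ∀ i, ‖u i‖ ≤ ρ := fun i => (norm_le_pi_norm u i).trans hcz
    choose m hm using fun i => Padic.exists_natCast_mul_sub_le hMπ ((hui i).trans hρt)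
      (mul_pos hq0 hρ0)
    have hmρ : ∀ i, ‖(m i : ℚ_[p]) * (M * π)‖ ≤ ρ := fun i => by
      simpa using norm_add_le_of_le_of_le ((hm i).trans hqρ) (hui i)
    have hsingle : ∀ i, ‖(Pi.single i π : Fin d → ℚ_[p])‖ = ‖π‖ := fun i => Pi.norm_single ..
    -- `b i` is the coordinate vector of the correcting power, close to the `i`-th component of the
    -- error `u`.
    choose b hb hbpow hbsub using fun i =>
      P.exists_param_eq_pow (x := Pi.single i π) ((hsingle i).trans_le hπ) (M * m i)
    have hbr : ∀ i, ‖b i‖ ≤ P.radius := fun i => (hb i).trans ((hsingle i).trans_le hπ)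
    have hbu : ∀ i, ‖b i - Pi.single i (u i)‖ ≤ (p : ℝ)⁻¹ * ρ := fun i => by
      have e1 : ‖b i - ((M * m i : ℕ) : ℚ_[p]) • (Pi.single i π : Fin d → ℚ_[p])‖ ≤
          (p : ℝ)⁻¹ * ρ := by
        refine (hbsub i).trans (mul_le_mul_of_nonneg_left ?_ hq0.le)
        rw [hsingle, ← norm_mul]
        refine Eq.trans_le (congrArg norm ?_) (hmρ i)
        push_cast
        ring
      have e2 : ‖((M * m i : ℕ) : ℚ_[p]) • (Pi.single i π : Fin d → ℚ_[p]) -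
          Pi.single i (u i)‖ ≤ (p : ℝ)⁻¹ * ρ := by
        rw [← Pi.single_smul, ← Pi.single_sub, Pi.norm_single]
        refine Eq.trans_le (congrArg norm ?_) (hm i)
        rw [smul_eq_mul]
        push_cast
        ring
      simpa using norm_add_le_of_le_of_le e1 e2
    have hbρ : ∀ i, ‖b i‖ ≤ ρ := fun i => by
      have := norm_add_le_of_le_of_le ((hbu i).trans hqρ)
        ((Pi.norm_single (G := fun _ : Fin d => ℚ_[p]) (i := i) (u i)).trans_le (hui i))
      simpa using this
    have hmul : ∀ i, ‖P.mul (c i) (b i) - c i - b i‖ ≤ (p : ℝ)⁻¹ * ρ := fun i => by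
      have := P.norm_mul_sub_le (c i) (b i) (c i) 0 (hc i) (hbr i) (hc i) h0
      rw [P.mul_zero _ (hc i), sub_self, norm_zero, sub_zero, sub_zero,
        max_eq_right (norm_nonneg _)] at this
      exact this.trans (mul_le_mul hεq (hbρ i) (norm_nonneg _) hq0.le)
    have hcr : ∀ i, ‖P.mul (c i) (b i)‖ ≤ P.radius := fun i =>
      P.norm_mul_le hε le_rfl (hc i) (hbr i)
    refine ⟨fun i => P.mul (c i) (b i), hcr, fun i => ?_, ?_⟩
    · rw [P.param_mul _ _ (hc i) (hbr i), hbpow, pow_mul]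
      exact mul_mem (hcpow i) ⟨m i, rfl⟩
    · have hdiff : ∀ i, ‖P.mul (c i) (b i) - c i‖ ≤ ρ := fun i => by
        simpa using norm_add_le_of_le_of_le ((hmul i).trans hqρ) (hbρ i)
      have hprod := (P.norm_prod_sub_prod_sub_sum_le (by positivity) hε hcr hc hρ0.le hdiff).2
      have hprod' := hprod.trans (mul_le_mul_of_nonneg_right hεq hρ0.le)
      have hsum : ‖∑ i, (P.mul (c i) (b i) - c i - Pi.single i (u i))‖ ≤ (p : ℝ)⁻¹ * ρ := by
        refine IsUltrametricDist.norm_sum_le_of_forall_le_of_nonneg (by positivity) fun i _ => ?_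
        refine Eq.trans_le (congrArg norm ?_) (norm_add_le_of_le_of_le (hmul i) (hbu i))
        abel
      rw [Finset.sum_sub_distrib, Finset.univ_sum_single] at hsum
      have := norm_add_le_of_le_of_le hprod' hsum
      rw [← norm_neg] at this
      convert this using 1
      · congr 1
        rw [hu]
        abel
      · rw [hρ, pow_succ]
        ring

variable [IsTopologicalGroup G]

/-- A `p`-adic analytic group with compact open subgroup `K` has elements `g 1, …, g d` in `K` such
that the products of elements of the procyclic subgroups generated by the `g i ^ M` form a
neighbourhood of `1`. -/
theorem IsPAdicAnalyticGroup.exists_generators [T2Space G] (hG : IsPAdicAnalyticGroup p G)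
    {K : Subgroup G} (hKo : IsOpen (K : Set G)) (hKc : IsCompact (K : Set G)) :
    ∃ (d : ℕ) (g : Fin d → G), (∀ i, g i ∈ K) ∧ ∀ M : ℕ, 0 < M →
      (fun x : Fin d → G => (List.ofFn x).prod) ''
        Set.univ.pi (fun i => closure (Submonoid.powers (g i ^ M) : Set G)) ∈ 𝓝 (1 : G) := by
  obtain ⟨d, hC, hL⟩ := hG
  have hp1 : (1 : ℝ) < p := mod_cast (Fact.out : p.Prime).one_lt
  have hq1 : (p : ℝ)⁻¹ < 1 := inv_lt_one_of_one_lt₀ hp1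
  have hε : (p : ℝ)⁻¹ ^ 2 ≤ 1 := pow_le_one₀ (by positivity) hq1.le
  obtain ⟨P, hP⟩ := exists_almostAdditiveParam ℚ_[p] (Fin d → ℚ_[p])
    (hKo.mem_nhds K.one_mem) (ε := (p : ℝ)⁻¹ ^ 2) (by positivity)
  obtain ⟨π, hπ0, hπ⟩ := NormedField.exists_norm_lt ℚ_[p] P.radius_pos
  have hgK : ∀ i, P.param (Pi.single i π) ∈ K := fun i =>
    hP _ ((Pi.norm_single (G := fun _ : Fin d => ℚ_[p]) (i := i) π).trans_le hπ.le)
  refine ⟨d, fun i => P.param (Pi.single i π), hgK, fun M hM => ?_⟩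
  have ht0 : 0 < ‖(M : ℚ_[p]) * π‖ := norm_pos_iff.2
    (mul_ne_zero (Nat.cast_ne_zero.2 hM.ne') (norm_pos_iff.1 hπ0))
  have htr : ‖(M : ℚ_[p]) * π‖ ≤ P.radius := by
    rw [norm_mul]
    refine (mul_le_of_le_one_left (norm_nonneg _) ?_).trans hπ.le
    exact_mod_cast Padic.norm_int_le_one (p := p) M
  -- The neighbourhood is the image of the ball of radius `‖M * π‖`; its points are limits of
  -- products of powers, and the set of products of the closures is compact, hence closed.
  refine mem_of_superset (P.image_mem_nhds _ ht0 htr) ?_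
  rintro _ ⟨z, hz, rfl⟩
  rw [mem_closedBall_zero_iff] at hz
  choose c hc hcpow hcz using
    P.exists_prod_pow_near (norm_pos_iff.1 hπ0) hπ.le hM hz
  have hlim : Tendsto (fun n => P.prod (List.ofFn (c n))) atTop (𝓝 z) := by
    rw [tendsto_iff_norm_sub_tendsto_zero]
    refine squeeze_zero (fun _ => norm_nonneg _)
      (fun n => (norm_sub_rev _ _).trans_le (hcz n)) ?_
    simpa using (tendsto_pow_atTop_nhds_zero_of_lt_one (by positivity) hq1).const_mul
      ‖(M : ℚ_[p]) * π‖
  have hlim' : Tendsto (fun n => P.param (P.prod (List.ofFn (c n)))) atTop (𝓝 (P.param z)) := by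
    refine (P.continuousOn z (by simpa using hz.trans htr)).tendsto.comp
      (tendsto_nhdsWithin_iff.2 ⟨hlim, Eventually.of_forall fun n => ?_⟩)
    simpa using P.norm_prod_le hε P.radius_pos.le le_rfl (hc n)
  have hcont : Continuous fun x : Fin d → G => (List.ofFn x).prod := by
    simp only [List.ofFn_eq_map]
    exact continuous_list_prod _ fun i _ => continuous_apply i
  have hclosed : IsClosed ((fun x : Fin d → G => (List.ofFn x).prod) '' Set.univ.pi (fun i =>
      closure (Submonoid.powers (P.param (Pi.single i π) ^ M) : Set G))) := by
    refine ((isCompact_univ_pi fun i => ?_).image hcont).isClosed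
    exact hKc.of_isClosed_subset isClosed_closure
      (closure_minimal (Submonoid.powers_le.2 (K.pow_mem (hgK i) M)) hKc.isClosed)
  refine hclosed.mem_of_tendsto hlim' (Eventually.of_forall fun n => ?_)
  rw [P.param_prod hε (hc n)]
  exact ⟨_, fun i _ => subset_closure (hcpow n i), rfl⟩

end PadicGenerators

/-! ### Conclusion -/

theorem IsPAdicAnalyticGroup.t2Space {p : ℕ} [Fact p.Prime] {G : Type*} [Group G]
    [TopologicalSpace G] [IsTopologicalGroup G] (hG : IsPAdicAnalyticGroup p G) : T2Space G := by
  obtain ⟨d, hC, -⟩ := hG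
  have := ChartedSpace.t1Space (Fin d → ℚ_[p]) G
  infer_instance

theorem corollary4p3 {p : ℕ} [Fact p.Prime]
    {G : Type*} [Group G] [TopologicalSpace G] [IsTopologicalGroup G]
    (hG : IsPAdicAnalyticGroup p G)
    {k : Type*} [Field k] (hk : 0 < ringChar k)
    {V : Type*} [AddCommGroup V] [Module k V] (ρ : Representation k G V) :
    SmoothRep.smoothPart (SmoothRep.quotientSmoothPart ρ) = ⊥ := by
  have := hG.t2Space
  have hex := hG.exists_compact_open_subgroup
  rw [eq_bot_iff]
  intro w hw
  obtain ⟨v, rfl⟩ := Submodule.mkQ_surjective _ w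
  obtain ⟨K, hKo, hKc, hK⟩ := (SmoothRep.mem_smoothPart_iff hex _ _).1 hw
  have hv : ∀ g ∈ K, ρ g v - v ∈ SmoothRep.smoothPart ρ := fun g hg =>
    (Submodule.Quotient.eq _).1 (hK g hg)
  obtain ⟨d, g, hgK, hg⟩ := hG.exists_generators hKo hKc
  choose M hM hMv using fun i =>
    SmoothRep.exists_closure_powers_le_vectorStabilizer hex hk ρ hKc hv (hgK i)
  rw [Submodule.mem_bot, Submodule.mkQ_apply, Submodule.Quotient.mk_eq_zero,
    SmoothRep.mem_smoothPart_iff_isOpen hex]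
  -- The product of the `M i` is a common exponent, being a multiple of each `M i`.
  refine Subgroup.isOpen_of_mem_nhds _ (g := 1) (mem_of_superset
    (hg (∏ i, M i) (Finset.prod_pos fun i _ => hM i)) ?_)
  rintro _ ⟨x, hx, rfl⟩
  refine list_prod_mem fun y hy => ?_
  obtain ⟨i, rfl⟩ := (List.mem_ofFn' x y).1 hy
  refine hMv i (closure_mono (Submonoid.powers_le.2 ?_) (hx i trivial))
  obtain ⟨m, hm⟩ := Finset.dvd_prod_of_mem M (Finset.mem_univ i)
  exact ⟨m, by simp only [hm, pow_mul]⟩
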